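/- Let $n\ge 0$ be the number of degrees of freedom, with canonical coordinates $(q,p)=(q_1,\dots,q_n,p_1,\dots,p_n)\in\mathbb R^{2n}$ and Poisson bracket $\{A,B\}=\sum_{i=1}^n\bigl(\frac{\partial A}{\partial q_i}\frac{\partial B}{\partial p_i}-\frac{\partial A}{\partial p_i}\frac{\partial B}{\partial q_i}\bigr)$. Terminology. On an open set $D$, a *first integral* of the system $dx_1/P_1=\dots=dx_N/P_N$ is a $C^1$ function that is constant along every differentiable curve in $D$, defined on an open interval, whose velocity is everywhere a multiple of $(P_1,\dots,P_N)$. Functions $u_1,\dots,u_m$ are *independent* at a point if their differentials there are linearly independent. A *conserved quantity* on $D$ is a $C^1$ function that is constant along every solution of Hamilton's equations $\dot q_i=\partial H/\partial p_i$, $\dot p_i=-\partial H/\partial q_i$ in $D$. We say that $f=\Phi(u_1,\dots,u_m)$ on $W$ if this identity holds on $W$ for some $C^1$ function $\Phi$ on an open subset of $\mathbb R^m$ that contains the values $(u_1,\dots,u_m)(w)$, $w\in W$; and that $f$ is *locally* of this form on $D$ if every point of $D$ has an open neighbourhood $W\subseteq D$ on which $f=\Phi(u_1,\dots,u_m)$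 for some such $\Phi$. **I. General case.** Let $D\subseteq\mathbb R^{2n}\times\mathbb R$ be open and $H(q,p,t)$ be $C^2$ on $D$. Consider the subsidiary system $$\frac{dq_1}{\partial H/\partial p_1}=\dots=\frac{dq_n}{\partial H/\partial p_n}=-\frac{dp_1}{\partial H/\partial q_1}=\dots=-\frac{dp_n}{\partial H/\partial q_n}=dt .\tag{S}$$ 1. For every $C^1$ function $f(q,p,t)$ on $D$, along every solution of Hamilton's equations in $D$, $\frac{df}{dt}=\{f,H\}+\frac{\partial f}{\partial t}$. 2. For a $C^1$ function $f$ on $D$ the following are equivalent: $f$ is a conserved quantity; $\{f,H\}+\frac{\partial f}{\partial t}=0$ on $D$; $f$ is a first integral of (S). 3. Let $u_1,\dots,u_{2n}$ be first integrals of (S) on $D$ that are independent at every point of $D$. Then a function $f$ is a conserved quantity on $D$ if and only if it is locally of the form $\Phi(u_1,\dots,u_{2n})$. If moreover all sets $\{z\in D: u_k(z)=c_k,\ k=1,\dots,2n\}$, $c\in\mathbb R^{2n}$, are connected (or empty), then $f$ is a conserved quantity on $D$ if and only if $f=\Phi(u_1,\dots,u_{2n})$ on all of $D$. 4. Every point of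 $D$ has an open neighbourhood in $D$ on which there are $2n$ first integrals of (S) that are independent at every point of the neighbourhood; and if $m$ first integrals of (S) on $D$ are independent at some point of $D$, then $m\le 2n$. **II. Time-independent case.** Let $D\subseteq\mathbb R^{2n}$ be open and $H(q,p)$ be $C^2$ on $D$. Consider time-independent quantities $f(q,p)$ and the subsidiary system $$\frac{dq_1}{\partial H/\partial p_1}=\dots=\frac{dq_n}{\partial H/\partial p_n}=-\frac{dp_1}{\partial H/\partial q_1}=\dots=-\frac{dp_n}{\partial H/\partial q_n}.\tag{S$_0$}$$ 1. For a $C^1$ function $f$ on $D$ the following are equivalent: $f$ is a conserved quantity; $\{f,H\}=0$ on $D$; $f$ is a first integral of (S$_0$). 2. Every point of $D$ at which $dH\neq 0$ has an open neighbourhood in $D$ on which there are $2n-1$ first integrals of (S$_0$) that are independent at every point of the neighbourhood. 3. Suppose that the points with $dH\ne 0$ are dense in $D$. If $u_1,\dots,u_{2n-1}$ are first integrals of (S$_0$) on $D$, independent at every point of $D$, then a function $f$ is a conserved quantity on $D$ if and only if it is locally of the form $\Phi(u_1,\dots,u_{2n-1})$; if moreover all joint level sets of $u_1,\dots,u_{2n-1}$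 in $D$ are connected (or empty), this holds if and only if $f=\Phi(u_1,\dots,u_{2n-1})$ on all of $D$. If $m$ first integrals of (S$_0$) on $D$ are independent at some point of $D$, then $m\le 2n-1$. -/

import Mathlib

open Set

noncomputable section

namespace HamiltonianMechanics

section Characteristics

variable {E : Type*} [NormedAddCommGroup E] [NormedSpace ℝ E]

/-- A curve `γ`, differentiable on the open interval `I` and contained in `D`, that solves the
subsidiary system `dx₁ / P₁ = dx₂ / P₂ = ⋯` of the vector field `P`: its velocity is everywhere
proportional to `P` (where a component of `P` is zero, the ratio is read as `dxᵢ = 0`). -/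
def IsCharacteristicCurve (P : E → E) (D : Set E) (I : Set ℝ) (γ : ℝ → E) : Prop :=
  IsOpen I ∧ I.OrdConnected ∧
    ∀ s ∈ I, γ s ∈ D ∧ ∃ c : ℝ, HasDerivAt γ (c • P (γ s)) s

/-- A first integral on `D` of the subsidiary system of `P`: a `C¹` function `u` such that
`u = const` along every solution curve of that system in `D`. -/
def IsFirstIntegral (P : E → E) (D : Set E) (u : E → ℝ) : Prop :=
  ContDiffOn ℝ 1 u D ∧
    ∀ (I : Set ℝ) (γ : ℝ → E), IsCharacteristicCurve P D I γ →
      ∀ s ∈ I, ∀ s' ∈ I, u (γ s) = u (γ s')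

/-- The functions `u k` are independent at `z`: their differentials at `z` are linearly
independent. -/
def IndependentAt {m : ℕ} (u : Fin m → E → ℝ) (z : E) : Prop :=
  LinearIndependent ℝ (fun k => fderiv ℝ (u k) z)

/-- On `W`, the function `f` is a `C¹` function of `u₁, …, uₘ`: `f = Φ(u₁, …, uₘ)`. -/
def IsFunctionOf {m : ℕ} (u : Fin m → E → ℝ) (W : Set E) (f : E → ℝ) : Prop :=
  ∃ V : Set (Fin m → ℝ), IsOpen V ∧ (∀ w ∈ W, (fun k => u k w) ∈ V) ∧
    ∃ Φ : (Fin m → ℝ) → ℝ, ContDiffOn ℝ 1 Φ V ∧ ∀ w ∈ W, f w = Φ (fun k => u k w)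

/-- Near every point of `D`, the function `f` is a `C¹` function of `u₁, …, uₘ`. -/
def IsLocallyFunctionOf {m : ℕ} (u : Fin m → E → ℝ) (D : Set E) (f : E → ℝ) : Prop :=
  ∀ z ∈ D, ∃ W : Set E, IsOpen W ∧ z ∈ W ∧ W ⊆ D ∧ IsFunctionOf u W f

end Characteristics

/-- Phase space of `n` degrees of freedom: points `(q, p)`. -/
abbrev Phase (n : ℕ) : Type := (Fin n → ℝ) × (Fin n → ℝ)

/-- Extended phase space: points `((q, p), t)`. -/
abbrev ExtPhase (n : ℕ) : Type := Phase n × ℝ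

variable {n : ℕ}

/-- `∂A/∂qᵢ` -/
def partialQ (A : Phase n → ℝ) (i : Fin n) (x : Phase n) : ℝ :=
  fderiv ℝ A x (Pi.single i 1, 0)

/-- `∂A/∂pᵢ` -/
def partialP (A : Phase n → ℝ) (i : Fin n) (x : Phase n) : ℝ :=
  fderiv ℝ A x (0, Pi.single i 1)

/-- The Poisson bracket `{A, B}`. -/
def poisson (A B : Phase n → ℝ) (x : Phase n) : ℝ :=
  ∑ i, (partialQ A i x * partialP B i x - partialP A i x * partialQ B i x)

/-- The Hamiltonian vector field `(∂H/∂p, -∂H/∂q)`. -/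
def hamField (H : Phase n → ℝ) (x : Phase n) : Phase n :=
  (fun i => partialP H i x, fun i => -partialQ H i x)

/-- A function on extended phase space, frozen at time `t`. -/
def atTime (f : ExtPhase n → ℝ) (t : ℝ) : Phase n → ℝ := fun x => f (x, t)

/-- `{f, H} + ∂f/∂t` at the point `z = ((q, p), t)`. -/
def totalDeriv (H f : ExtPhase n → ℝ) (z : ExtPhase n) : ℝ :=
  poisson (atTime f z.2) (atTime H z.2) z.1 + deriv (fun t => f (z.1, t)) z.2

/-- The vector field `(∂H/∂p, -∂H/∂q, 1)` on extended phase space; its subsidiary system is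
`dqᵢ / (∂H/∂pᵢ) = -dpᵢ / (∂H/∂qᵢ) = dt`. -/
def extHamField (H : ExtPhase n → ℝ) (z : ExtPhase n) : ExtPhase n :=
  (hamField (atTime H z.2) z.1, 1)

/-- `x(t) = (q(t), p(t))`, for `t` in the open interval `I`, is a motion of the system inside `D`:
it solves Hamilton's equations `q̇ = ∂H/∂p`, `ṗ = -∂H/∂q`. -/
def IsMotion (H : ExtPhase n → ℝ) (D : Set (ExtPhase n)) (I : Set ℝ) (x : ℝ → Phase n) : Prop :=
  IsOpen I ∧ I.OrdConnected ∧
    ∀ t ∈ I, (x t, t) ∈ D ∧ HasDerivAt x (hamField (atTime H t) (x t)) t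

/-- A conserved quantity on `D`: a `C¹` function `f(q, p, t)` that is constant along every
motion. -/
def IsConserved (H : ExtPhase n → ℝ) (D : Set (ExtPhase n)) (f : ExtPhase n → ℝ) : Prop :=
  ContDiffOn ℝ 1 f D ∧
    ∀ (I : Set ℝ) (x : ℝ → Phase n), IsMotion H D I x →
      ∀ t ∈ I, ∀ t' ∈ I, f (x t, t) = f (x t', t')

/-- A function on phase space, regarded as a time-independent function on extended phase space. -/
def lift (f : Phase n → ℝ) : ExtPhase n → ℝ := fun z => f z.1

/-- A time-independent conserved quantity `f(q, p)` on `D` of the time-independent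
Hamiltonian `H(q, p)`. -/
def IsConservedAutonomous (H : Phase n → ℝ) (D : Set (Phase n)) (f : Phase n → ℝ) : Prop :=
  IsConserved (lift H) (D ×ˢ univ) (lift f)

end HamiltonianMechanics

end

/-! Write `P` for the Hamiltonian field, on phase space or extended by `1` in the time direction; it
is `C¹` because `H` is `C²`. Everything follows from one equivalence (`isFirstIntegral_iff`): a `C¹`
function `f` is a first integral exactly when `df(P) = 0`. The chain rule gives one direction, and
an integral curve through every point gives the other. In coordinates `df(P)` is `{f, H} + ∂f/∂t`,
or `{f, H}` in the autonomous case, and motions are the integral curves parametrized by time, so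
conserved quantities are the same thing.

Counting is linear algebra: where `P ≠ 0`, differentials that kill `P` span at most a hyperplane of
the dual space. Independence is an open condition, so the bound extends to every point if the zeros
of `P` have empty interior. Hence the differential of any first integral lies in the span of a full
independent family `u`. Completing `u` to a chart shows that `f` depends locally on `u` alone
(`isLocallyFunctionOf_of_fderiv_mem_span`); connected level sets make this global.

Existence of a full family is rectification (`exists_independentAt_annihilating`): flow out of a
hyperplane transversal to `P` and use the coordinates of the starting point. This needs a flow that
is `C¹` in time and initial point jointly, obtained from the implicit function theorem in a space of
continuous curves. -/

noncomputable section

open scoped Topology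

namespace ContinuousMap

/-! ### Differentiability of `γ ↦ g ∘ γ` on spaces of continuous maps -/

section Superposition

variable {K E F : Type*} [TopologicalSpace K] [CompactSpace K]
  [NormedAddCommGroup E] [NormedSpace ℝ E] [NormedAddCommGroup F] [NormedSpace ℝ F]

/-- Pointwise application of a continuous family of operators to a continuous family of vectors. -/
def pointwiseApply : C(K, E →L[ℝ] F) →L[ℝ] C(K, E) →L[ℝ] C(K, F) :=
  LinearMap.mkContinuous₂
    (LinearMap.mk₂ ℝ (fun (A : C(K, E →L[ℝ] F)) (h : C(K, E)) =>
      (⟨fun t => A t (h t), by fun_prop⟩ : C(K, F)))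
      (fun _ _ _ => by ext; simp) (fun _ _ _ => by ext; simp)
      (fun _ _ _ => by ext; simp) (fun _ _ _ => by ext; simp))
    1 (fun A h => by
      rw [one_mul]
      refine (ContinuousMap.norm_le _ (by positivity)).2 fun t => ?_
      exact ((A t).le_opNorm (h t)).trans (mul_le_mul (A.norm_coe_le_norm t) (h.norm_coe_le_norm t)
        (norm_nonneg _) ((norm_nonneg _).trans (A.norm_coe_le_norm t))))

/-- Uniform continuity of the derivative gives one `δ` for all points `γ t`, so the mean value
inequality bounds the remainder by `c ‖h‖` in the sup norm. -/
theorem hasFDerivAt_comp_left {g : E → F} (hg : ContDiff ℝ 1 g)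
    (hu : UniformContinuous (fderiv ℝ g)) (γ : C(K, E)) :
    HasFDerivAt (fun γ : C(K, E) => (⟨g, hg.continuous⟩ : C(E, F)).comp γ)
      (pointwiseApply ((⟨fderiv ℝ g, hu.continuous⟩ : C(E, E →L[ℝ] F)).comp γ)) γ := by
  rw [hasFDerivAt_iff_isLittleO_nhds_zero, Asymptotics.isLittleO_iff]
  intro c hc
  obtain ⟨δ, hδ, H⟩ := Metric.uniformContinuous_iff.1 hu c hc
  filter_upwards [Metric.ball_mem_nhds (0 : C(K, E)) hδ] with h hh
  rw [mem_ball_zero_iff] at hh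
  refine (ContinuousMap.norm_le _ (by positivity)).2 fun t => ?_
  have hball : ∀ x ∈ Metric.ball (γ t) δ, ‖fderiv ℝ g x - fderiv ℝ g (γ t)‖ ≤ c := fun x hx => by
    rw [← dist_eq_norm]
    exact (H hx).le
  have hmem : γ t + h t ∈ Metric.ball (γ t) δ := by
    rw [mem_ball_iff_norm, add_sub_cancel_left]
    exact (h.norm_coe_le_norm t).trans_lt hh
  have := (convex_ball (γ t) δ).norm_image_sub_le_of_norm_fderiv_le'
    (fun x _ => (hg.differentiable one_ne_zero) x) hball (Metric.mem_ball_self hδ) hmem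
  rw [add_sub_cancel_left] at this
  exact this.trans (mul_le_mul_of_nonneg_left (h.norm_coe_le_norm t) hc.le)

/-- The superposition operator of a `C¹` map with uniformly continuous derivative is `C¹`. -/
theorem contDiff_comp_left {g : E → F} (hg : ContDiff ℝ 1 g)
    (hu : UniformContinuous (fderiv ℝ g)) :
    ContDiff ℝ 1 (fun γ : C(K, E) => (⟨g, hg.continuous⟩ : C(E, F)).comp γ) :=
  contDiff_one_iff_hasFDerivAt.2
    ⟨_, pointwiseApply.continuous.comp (ContinuousMap.continuous_postcomp _),
      hasFDerivAt_comp_left hg hu⟩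

end Superposition

/-! ### Integration of curves on the unit interval -/

section Primitive

variable {E : Type*} [NormedAddCommGroup E] [NormedSpace ℝ E]

/-- The primitive of a curve on the unit interval that vanishes at `0`. -/
def unitPrimitive : C(unitInterval, E) →L[ℝ] C(unitInterval, E) :=
  have hc (γ : C(unitInterval, E)) : Continuous fun τ => γ (projIcc 0 1 zero_le_one τ) :=
    γ.continuous.comp continuous_projIcc
  LinearMap.mkContinuous
    { toFun γ := ⟨fun t => ∫ τ in (0 : ℝ)..t, γ (projIcc 0 1 zero_le_one τ),
        (intervalIntegral.continuous_primitive (fun _ _ => (hc γ).intervalIntegrable _ _) 0).comp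
          continuous_subtype_val⟩
      map_add' γ γ' := by
        ext t
        exact intervalIntegral.integral_add ((hc γ).intervalIntegrable _ _)
          ((hc γ').intervalIntegrable _ _)
      map_smul' c γ := by
        ext t
        exact intervalIntegral.integral_smul c _ }
    1 (fun γ => by
      refine (ContinuousMap.norm_le _ (by positivity)).2 fun t => ?_
      refine (intervalIntegral.norm_integral_le_of_norm_le_const
        fun τ _ => γ.norm_coe_le_norm _).trans ?_
      rw [one_mul, sub_zero, abs_of_nonneg t.2.1]
      exact mul_le_of_le_one_right (norm_nonneg _) t.2.2)

end Primitive

end ContinuousMap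

/-! ### Local flows of `C¹` vector fields -/

section Flow

variable {E : Type*} [NormedAddCommGroup E] [NormedSpace ℝ E] [FiniteDimensional ℝ E]

/-- Multiplication by a bump function supported where `P` is `C¹`. Compact support makes the
derivative uniformly continuous, as differentiating the superposition operator requires. -/
theorem ContDiffAt.exists_contDiff_hasCompactSupport_eventuallyEq {F : Type*}
    [NormedAddCommGroup F] [NormedSpace ℝ F] {P : E → F} {x₀ : E} (hP : ContDiffAt ℝ 1 P x₀) :
    ∃ Q : E → F, ContDiff ℝ 1 Q ∧ HasCompactSupport Q ∧ Q =ᶠ[𝓝 x₀] P := by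
  have hs : {x | ContDiffAt ℝ 1 P x} ∈ 𝓝 x₀ := hP.eventually (by simp)
  obtain ⟨δ, hδ, hball⟩ := Metric.mem_nhds_iff.1 hs
  let ρ : ContDiffBump x₀ := ⟨δ / 3, δ / 2, by positivity, by linarith⟩
  refine ⟨fun x => ρ x • P x, contDiff_iff_contDiffAt.2 fun x => ?_,
    ρ.hasCompactSupport.smul_right, ?_⟩
  · by_cases hx : x ∈ tsupport ρ
    · rw [ρ.tsupport_eq] at hx
      exact ρ.contDiffAt.smul (hball (Metric.closedBall_subset_ball (half_lt_self hδ) hx))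
    · have h0 : (fun x => ρ x • P x) =ᶠ[𝓝 x] fun _ => 0 := by
        filter_upwards [notMem_tsupport_iff_eventuallyEq.1 hx] with y hy
        simp [hy]
      exact contDiffAt_const.congr_of_eventuallyEq h0
  · filter_upwards [ρ.eventuallyEq_one] with x hx
    simp [hx]

/-- A compactly supported `C¹` vector field has a local flow that is `C¹` in time and
initial point. -/
theorem exists_contDiffAt_flow_of_hasCompactSupport {P : E → E} (hP : ContDiff ℝ 1 P)
    (hc : HasCompactSupport P) (x₀ : E) :
    ∃ α : E × ℝ → E, ContDiffAt ℝ 1 α (x₀, 0) ∧ (∀ᶠ x in 𝓝 x₀, α (x, 0) = x) ∧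
      ∀ᶠ v in 𝓝 (x₀, (0 : ℝ)), HasDerivAt (fun s => α (v.1, s)) (P (α v)) v.2 := by
  have hu : UniformContinuous (fderiv ℝ P) :=
    (hc.fderiv ℝ).uniformContinuous_of_continuous (hP.continuous_fderiv one_ne_zero)
  obtain ⟨T, hT, a, r, L, K, hr, hPL⟩ := IsPicardLindelof.of_contDiffAt_one (hP.contDiffAt (x := x₀))
  obtain ⟨α, hα, hαc⟩ :=
    (hPL 0).exists_forall_mem_closedBall_eq_hasDerivWithinAt_continuousOn
  simp only [zero_sub, zero_add] at hα hαc
  have hnear : Metric.closedBall x₀ r ×ˢ Icc (-T) T ∈ 𝓝 (x₀, (0 : ℝ)) :=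
    prod_mem_nhds (Metric.closedBall_mem_nhds _ hr) (Icc_mem_nhds (by linarith) hT)
  have hα0 : ContinuousAt α (x₀, 0) := hαc.continuousAt hnear
  have hx₀ : α (x₀, 0) = x₀ := (hα x₀ (Metric.mem_closedBall_self r.2)).1
  let Pc : C(E, E) := ⟨P, hP.continuous⟩
  -- The integral equation for the curve `t ↦ α (x, s * t)`. Rescaling time by `s` places all curves
  -- on the same interval and turns `s` into a parameter.
  let G : (E × ℝ) × C(unitInterval, E) → C(unitInterval, E) := fun v =>
    v.2 - ContinuousLinearMap.const ℝ unitInterval v.1.1 -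
      v.1.2 • ContinuousMap.unitPrimitive (Pc.comp v.2)
  let u₀ : (E × ℝ) × C(unitInterval, E) := ((x₀, 0), ContinuousMap.const _ x₀)
  have hG : ContDiff ℝ 1 G := by
    have h1 := ContinuousMap.contDiff_comp_left (K := unitInterval) hP hu
    have h2 : ContDiff ℝ 1 fun v : (E × ℝ) × C(unitInterval, E) =>
        ContinuousMap.unitPrimitive (Pc.comp v.2) :=
      ContinuousMap.unitPrimitive.contDiff.comp (h1.comp contDiff_snd)
    have h3 : ContDiff ℝ 1 fun v : (E × ℝ) × C(unitInterval, E) =>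
        ContinuousLinearMap.const ℝ unitInterval v.1.1 :=
      ContDiff.comp (g := ContinuousLinearMap.const (M := E) ℝ unitInterval)
        (ContinuousLinearMap.contDiff _) (contDiff_fst.comp contDiff_fst)
    exact (contDiff_snd.sub h3).sub ((contDiff_snd.comp contDiff_fst).smul h2)
  have hGu : G u₀ = 0 := by
    ext t
    simp [G, u₀]
  -- At `s = 0` the integral term drops out and `G` is `γ - x₀`, whose derivative in `γ` is the
  -- identity.
  have hinv : (fderiv ℝ G u₀ ∘L .inr ℝ (E × ℝ) C(unitInterval, E)).IsInvertible := by
    have : fderiv ℝ G u₀ ∘L .inr ℝ (E × ℝ) C(unitInterval, E) = ContinuousLinearMap.id ℝ _ := by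
      have h1 : HasFDerivAt (fun γ => G ((x₀, 0), γ))
          (fderiv ℝ G u₀ ∘L .inr ℝ (E × ℝ) C(unitInterval, E)) (ContinuousMap.const _ x₀) :=
        HasFDerivAt.comp (f := fun γ => ((x₀, (0 : ℝ)), γ)) (ContinuousMap.const _ x₀)
          (hG.differentiable one_ne_zero u₀).hasFDerivAt (hasFDerivAt_prodMk_right _ _)
      have h2 : HasFDerivAt (fun γ => G ((x₀, 0), γ)) (ContinuousLinearMap.id ℝ _)
          (ContinuousMap.const _ x₀) := by
        simp only [G, zero_smul, sub_zero]
        exact (hasFDerivAt_id _).sub_const _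
      exact h1.unique h2
    rw [this]
    exact ContinuousLinearMap.isInvertible_equiv (f := ContinuousLinearEquiv.refl ℝ _)
  let ψ := hG.contDiffAt.implicitFunction one_ne_zero hinv
  have hψ : ContDiffAt ℝ 1 ψ (x₀, 0) := hG.contDiffAt.contDiffAt_implicitFunction one_ne_zero hinv
  have hψu := hG.contDiffAt.eventually_apply_eq_iff_implicitFunction one_ne_zero hinv
  have hderiv : ∀ x ∈ Metric.closedBall x₀ r, ∀ s ∈ Ioo (-T) T,
      HasDerivAt (fun s => α (x, s)) (P (α (x, s))) s := fun x hx s hs =>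
    ((hα x hx).2 s (Ioo_subset_Icc_self hs)).hasDerivAt (Icc_mem_nhds hs.1 hs.2)
  have hsub : ∀ s ∈ Ioo (-T) T, ∀ t : unitInterval, s * t ∈ Ioo (-T) T := fun s hs t => by
    have h1 : |s * t| ≤ |s| := by
      rw [abs_mul, abs_of_nonneg t.2.1]
      exact mul_le_of_le_one_right (abs_nonneg _) t.2.2
    exact abs_lt.1 (h1.trans_lt (abs_lt.2 hs))
  have hIoo : Metric.closedBall x₀ r ×ˢ Ioo (-T) T ∈ 𝓝 (x₀, (0 : ℝ)) :=
    prod_mem_nhds (Metric.closedBall_mem_nhds _ hr) (Ioo_mem_nhds (by linarith) hT)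
  have hcurve : ∀ v ∈ Metric.closedBall x₀ r ×ˢ Ioo (-T) T,
      Continuous fun t : unitInterval => α (v.1, v.2 * t) := fun v hv =>
    continuous_iff_continuousAt.2 fun t =>
      ContinuousAt.comp (g := fun s => α (v.1, s)) (f := fun t : unitInterval => v.2 * (t : ℝ))
        (hderiv v.1 hv.1 _ (hsub v.2 hv.2 t)).continuousAt (by fun_prop)
  classical
  -- The rescaled Picard–Lindelöf curves; the value outside the domain of the flow is irrelevant.
  let c : E × ℝ → C(unitInterval, E) := fun v =>
    if hv : v ∈ Metric.closedBall x₀ r ×ˢ Ioo (-T) T then ⟨_, hcurve v hv⟩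
    else ContinuousMap.const _ x₀
  have hc_apply : ∀ v ∈ Metric.closedBall x₀ r ×ˢ Ioo (-T) T, ∀ t, c v t = α (v.1, v.2 * t) :=
    fun v hv t => by simp only [c, dif_pos hv]; rfl
  have hc_tendsto : Filter.Tendsto c (𝓝 (x₀, 0)) (𝓝 (ContinuousMap.const _ x₀)) := by
    rw [Metric.tendsto_nhds]
    intro δ hδ
    have h1 := Metric.tendsto_nhds.1 hα0.tendsto (δ / 2) (half_pos hδ)
    obtain ⟨ρ, hρ, hρb⟩ := Metric.eventually_nhds_iff_ball.1 h1
    filter_upwards [hIoo, Metric.ball_mem_nhds (x₀, (0 : ℝ)) hρ] with v hv hvρ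
    refine lt_of_le_of_lt ((ContinuousMap.dist_le (half_pos hδ).le).2 fun t => ?_) (half_lt_self hδ)
    rw [hc_apply v hv t, ContinuousMap.const_apply]
    rw [← hx₀]
    refine (hρb (v.1, v.2 * t) ?_).le
    rw [← ball_prod_same] at hvρ ⊢
    refine ⟨hvρ.1, ?_⟩
    have h2 := hvρ.2
    rw [mem_ball_zero_iff, Real.norm_eq_abs] at h2 ⊢
    rw [abs_mul, abs_of_nonneg t.2.1]
    exact (mul_le_of_le_one_right (abs_nonneg _) t.2.2).trans_lt h2
  have hGc : ∀ v ∈ Metric.closedBall x₀ r ×ˢ Ioo (-T) T, G (v, c v) = 0 := fun v hv => by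
    ext t
    have h1 : ∀ τ ∈ uIcc (0 : ℝ) t, HasDerivAt (fun τ => α (v.1, v.2 * τ))
        (v.2 • P (c v (projIcc 0 1 zero_le_one τ))) τ := fun τ hτ => by
      rw [uIcc_of_le t.2.1] at hτ
      have hτ1 : τ ∈ Icc (0 : ℝ) 1 := ⟨hτ.1, hτ.2.trans t.2.2⟩
      rw [projIcc_of_mem _ hτ1, hc_apply v hv]
      exact (hderiv v.1 hv.1 (v.2 * τ) (hsub v.2 hv.2 ⟨τ, hτ1⟩)).scomp τ
        (by simpa using (hasDerivAt_id τ).const_mul v.2)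
    have h2 := intervalIntegral.integral_eq_sub_of_hasDerivAt h1
      (Continuous.intervalIntegrable (by
        exact (hP.continuous.comp ((c v).continuous.comp continuous_projIcc)).const_smul _) _ _)
    rw [intervalIntegral.integral_smul] at h2
    have h3 : G (v, c v) t = α (v.1, v.2 * t) - v.1 -
        v.2 • ∫ τ in (0 : ℝ)..t, P (c v (projIcc 0 1 zero_le_one τ)) := by
      rw [← hc_apply v hv t]
      rfl
    rw [h3, h2, mul_zero, (hα v.1 hv.1).1]
    simp
  -- The curves `c v` solve `G = 0` and tend uniformly to the constant curve, so local uniqueness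
  -- identifies them with the `C¹` implicit function. The flow is its value at `t = 1`.
  have hψc : ∀ᶠ v in 𝓝 (x₀, (0 : ℝ)), ψ v = c v := by
    filter_upwards [(Filter.tendsto_id.prodMk_nhds hc_tendsto).eventually hψu, hIoo] with v hv hvI
    exact hv.1 ((hGc v hvI).trans hGu.symm)
  refine ⟨α, ?_, ?_, ?_⟩
  · have h1 : ContDiffAt ℝ 1 (fun v => ContinuousMap.evalCLM ℝ (1 : unitInterval) (ψ v)) (x₀, 0) :=
      ContDiffAt.comp _ (ContinuousLinearMap.contDiff _).contDiffAt hψ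
    refine h1.congr_of_eventuallyEq ?_
    filter_upwards [hψc, hIoo] with v hv hvI
    rw [hv, ContinuousMap.evalCLM_apply, hc_apply v hvI]
    simp
  · filter_upwards [Metric.closedBall_mem_nhds x₀ hr] with x hx using (hα x hx).1
  · filter_upwards [hIoo] with v hv using hderiv v.1 hv.1 v.2 hv.2

/-- A vector field that is `C¹` at a point has a local flow there that is `C¹` in time and
initial point. -/
theorem ContDiffAt.exists_contDiffAt_flow {P : E → E} {x₀ : E} (hP : ContDiffAt ℝ 1 P x₀) :
    ∃ α : E × ℝ → E, ContDiffAt ℝ 1 α (x₀, 0) ∧ (∀ᶠ x in 𝓝 x₀, α (x, 0) = x) ∧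
      ∀ᶠ v in 𝓝 (x₀, (0 : ℝ)), HasDerivAt (fun s => α (v.1, s)) (P (α v)) v.2 := by
  obtain ⟨Q, hQ, hQc, hQP⟩ := hP.exists_contDiff_hasCompactSupport_eventuallyEq
  obtain ⟨α, hα, hα0, hαd⟩ := exists_contDiffAt_flow_of_hasCompactSupport hQ hQc x₀
  refine ⟨α, hα, hα0, ?_⟩
  have h0 : Filter.Tendsto α (𝓝 (x₀, 0)) (𝓝 x₀) := by
    simpa [hα0.self_of_nhds] using hα.continuousAt.tendsto
  filter_upwards [hαd, h0.eventually hQP] with v hv hvP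
  rwa [← hvP]

end Flow

namespace HamiltonianMechanics

/-! ### Independent functions, rectification and functional dependence -/

section FunctionalDependence

variable {E : Type*} [NormedAddCommGroup E] [NormedSpace ℝ E]

theorem continuousAt_fderiv_of_contDiffAt {F : Type*} [NormedAddCommGroup F] [NormedSpace ℝ F]
    {f : E → F} {x : E} (hf : ContDiffAt ℝ 1 f x) : ContinuousAt (fderiv ℝ f) x :=
  (hf.fderiv_right (m := 0) (by simp)).continuousAt

theorem IndependentAt.eventually {m : ℕ} {u : Fin m → E → ℝ} {z : E}
    (hu : ∀ k, ContDiffAt ℝ 1 (u k) z) (h : IndependentAt u z) :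
    ∀ᶠ w in 𝓝 z, IndependentAt u w :=
  (continuousAt_pi.2 fun k => continuousAt_fderiv_of_contDiffAt (hu k)).eventually
    (LinearIndependent.eventually h)

theorem exists_clm_apply_ne_zero {v : E} (hv : v ≠ 0) : ∃ ℓ : E →L[ℝ] ℝ, ℓ v ≠ 0 := by
  obtain ⟨ℓ, -, hℓ⟩ := exists_dual_vector ℝ v (by simpa using hv)
  exact ⟨ℓ, by rw [hℓ]; simpa using hv⟩

/-- A proper range lies in the kernel of some nonzero functional `g`, and the numbers `g (Pi.single
k 1)` are then the coefficients of a linear relation among the differentials. -/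
theorem IndependentAt.range_pi_fderiv_eq_top {m : ℕ} {u : Fin m → E → ℝ} {z : E}
    (h : IndependentAt u z) :
    (ContinuousLinearMap.pi fun k => fderiv ℝ (u k) z).range = ⊤ := by
  by_contra hne
  obtain ⟨g, hg0, hg⟩ := Submodule.exists_le_ker_of_lt_top _ (lt_top_iff_ne_top.2 hne)
  refine hg0 (LinearMap.pi_ext' fun k => LinearMap.ext_ring ?_)
  refine Fintype.linearIndependent_iff.1 h (fun k => g (Pi.single k 1)) ?_ k
  ext v
  have h1 : g (fun k => fderiv ℝ (u k) z v) = 0 := hg ⟨v, rfl⟩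
  rw [LinearMap.pi_apply_eq_sum_univ] at h1
  have h2 : ∀ k : Fin m, (fun j => if k = j then (1 : ℝ) else 0) = Pi.single k 1 := fun k => by
    ext j
    simp [Pi.single_apply, eq_comm]
  simpa [mul_comm, h2] using h1

theorem apply_eq_zero_of_mem_span {m : ℕ} {φ : Fin m → E →L[ℝ] ℝ} {v : E} (h : ∀ k, φ k v = 0)
    {ψ : E →L[ℝ] ℝ} (hψ : ψ ∈ Submodule.span ℝ (range φ)) : ψ v = 0 := by
  induction hψ using Submodule.span_induction with
  | mem x hx => obtain ⟨k, rfl⟩ := hx; exact h k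
  | zero => rfl
  | add x y _ _ hx hy => simp [hx, hy]
  | smul a x _ hx => simp [hx]

theorem IsLocallyFunctionOf.contDiffAt_and_fderiv_eq_zero {D : Set E} (hD : IsOpen D) {m : ℕ}
    {u : Fin m → E → ℝ} (hu : ∀ k, ContDiffOn ℝ 1 (u k) D) {f : E → ℝ}
    (hf : IsLocallyFunctionOf u D f) {z : E} (hz : z ∈ D) :
    ContDiffAt ℝ 1 f z ∧ ∀ v, (∀ k, fderiv ℝ (u k) z v = 0) → fderiv ℝ f z v = 0 := by
  obtain ⟨W, hWo, hzW, -, V, hV, hWV, Φ, hΦ, hfΦ⟩ := hf z hz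
  have hu' : ∀ k, ContDiffAt ℝ 1 (u k) z := fun k => (hu k).contDiffAt (hD.mem_nhds hz)
  have hΦ' : ContDiffAt ℝ 1 Φ fun k => u k z := hΦ.contDiffAt (hV.mem_nhds (hWV z hzW))
  have heq : f =ᶠ[𝓝 z] fun w => Φ fun k => u k w :=
    Filter.eventually_of_mem (hWo.mem_nhds hzW) hfΦ
  refine ⟨(hΦ'.comp z (contDiffAt_pi.2 hu')).congr_of_eventuallyEq heq, fun v hv => ?_⟩
  have h1 := ((hΦ'.differentiableAt one_ne_zero).hasFDerivAt.comp z
    (hasFDerivAt_pi.2 fun k => ((hu' k).differentiableAt one_ne_zero).hasFDerivAt))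
  rw [(h1.congr_of_eventuallyEq heq).fderiv]
  have h2 : (ContinuousLinearMap.pi fun k => fderiv ℝ (u k) z) v = 0 := funext hv
  rw [ContinuousLinearMap.comp_apply, h2, map_zero]

variable [FiniteDimensional ℝ E]

/-- Rectification: a vector field that is `C¹` at a point where it does not vanish is annihilated
near that point by the differential of a `C¹` map whose components are independent and
one fewer than the dimension. -/
theorem exists_independentAt_annihilating {P : E → E} {x₀ : E} (hP : ContDiffAt ℝ 1 P x₀)
    (hP₀ : P x₀ ≠ 0) {m : ℕ} (hm : Module.finrank ℝ E = m + 1) :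
    ∃ u : Fin m → E → ℝ, (∀ k, ContDiffAt ℝ 1 (u k) x₀) ∧
      (∀ k, ∀ᶠ z in 𝓝 x₀, fderiv ℝ (u k) z (P z) = 0) ∧ IndependentAt u x₀ := by
  obtain ⟨α, hα, hα0, hαd⟩ := hP.exists_contDiffAt_flow
  obtain ⟨ℓ, hℓ⟩ := exists_clm_apply_ne_zero hP₀
  -- A hyperplane transversal to `P x₀`. Below, `Θ (y, s)` starts at `x₀ + y` with `y ∈ S` and flows
  -- for time `s`.
  let S : Submodule ℝ E := LinearMap.ker (ℓ : E →ₗ[ℝ] ℝ)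
  have hS : Module.finrank ℝ S = m := by
    have h1 := LinearMap.finrank_range_add_finrank_ker (ℓ : E →ₗ[ℝ] ℝ)
    rw [LinearMap.range_eq_top.2 (LinearMap.surjective fun h => hℓ (by
      simpa using congrArg (fun φ => φ (P x₀)) h)), finrank_top, Module.finrank_self, hm] at h1
    change 1 + Module.finrank ℝ S = m + 1 at h1
    omega
  let b : Module.Basis (Fin m) ℝ S := Module.finBasisOfFinrankEq ℝ S hS
  let Θ : S × ℝ → E := fun v => α (x₀ + v.1, v.2)
  have hΘ0 : Θ 0 = x₀ := by simpa [Θ] using hα0.self_of_nhds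
  have hΘ : ContDiffAt ℝ 1 Θ 0 := by
    have h1 : ContDiffAt ℝ 1 (fun v : S × ℝ => (x₀ + (v.1 : E), v.2)) 0 :=
      (contDiffAt_const.add ((S.subtypeL.contDiff.comp contDiff_fst).contDiffAt)).prodMk
        contDiffAt_snd
    refine ContDiffAt.comp (g := α) (0 : S × ℝ) ?_ h1
    simpa using hα
  -- Near `x₀` the flow at time `0` is the identity, so `Θ (y, 0) = x₀ + y` for small `y`.
  have hDs : ∀ y : S, fderiv ℝ Θ 0 (y, 0) = y := fun y => by
    have h1 := (hΘ.differentiableAt one_ne_zero).hasFDerivAt.comp_hasDerivAt_of_eq (0 : ℝ)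
      (((hasDerivAt_id (0 : ℝ)).smul_const y).prodMk (hasDerivAt_const (0 : ℝ) (0 : ℝ)))
      (by simp; rfl)
    have h2 : HasDerivAt (fun s : ℝ => x₀ + s • (y : E)) (y : E) 0 := by
      simpa using ((hasDerivAt_id (0 : ℝ)).smul_const (y : E)).const_add x₀
    have h3 : (fun s : ℝ => x₀ + s • (y : E)) =ᶠ[𝓝 0] Θ ∘ fun s : ℝ => (id s • y, (0 : ℝ)) := by
      have h4 : Filter.Tendsto (fun s : ℝ => x₀ + s • (y : E)) (𝓝 0) (𝓝 x₀) := by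
        simpa using h2.continuousAt.tendsto
      filter_upwards [h4.eventually hα0] with s hs
      simp [Θ, hs]
    simpa using (h1.congr_of_eventuallyEq h3).unique h2
  have hDt : fderiv ℝ Θ 0 (0, 1) = P x₀ := by
    have h1 := (hΘ.differentiableAt one_ne_zero).hasFDerivAt.comp_hasDerivAt_of_eq (0 : ℝ)
      ((hasDerivAt_const (0 : ℝ) (0 : S)).prodMk (hasDerivAt_id (0 : ℝ))) rfl
    have h2 := hαd.self_of_nhds
    rw [show α (x₀, 0) = x₀ from hα0.self_of_nhds] at h2
    refine h1.unique ?_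
    simpa [Θ, Function.comp_def] using h2
  have hD : ∀ v : S × ℝ, fderiv ℝ Θ 0 v = v.1 + v.2 • P x₀ := fun v => by
    rw [← hDs, ← hDt, ← map_smul, ← map_add]
    simp
  have hinj : Function.Injective (fderiv ℝ Θ 0) := by
    rw [injective_iff_map_eq_zero]
    intro v hv
    rw [hD] at hv
    have h1 := congrArg ℓ hv
    rw [map_add, show ℓ v.1 = 0 from v.1.2, map_smul, map_zero, zero_add, smul_eq_mul,
      mul_eq_zero, or_iff_left hℓ] at h1
    rw [h1, zero_smul, add_zero] at hv
    exact Prod.ext (Subtype.ext hv) h1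
  have hdim : Module.finrank ℝ (S × ℝ) = Module.finrank ℝ E := by
    rw [Module.finrank_prod, Module.finrank_self, hS, hm]
  let A : (S × ℝ) ≃L[ℝ] E :=
    (LinearEquiv.ofInjectiveOfFinrankEq _ hinj hdim).toContinuousLinearEquiv
  have hA : HasFDerivAt Θ (A : S × ℝ →L[ℝ] E) 0 :=
    (hΘ.differentiableAt one_ne_zero).hasFDerivAt
  let e := hΘ.toOpenPartialHomeomorph Θ hA one_ne_zero
  have he0 : (0 : S × ℝ) ∈ e.source := hΘ.mem_toOpenPartialHomeomorph_source hA one_ne_zero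
  have he : ∀ v, e v = Θ v := fun _ => rfl
  have hx₀ : x₀ ∈ e.target := by
    have := e.map_source he0
    rwa [he, hΘ0] at this
  have hsymm0 : e.symm x₀ = 0 := by
    have := e.left_inv he0
    rwa [he, hΘ0] at this
  have hsymm : ContDiffAt ℝ 1 e.symm x₀ :=
    e.contDiffAt_symm hx₀ (f₀' := A) (by rw [hsymm0]; exact hA) (by rw [hsymm0]; exact hΘ)
  have hsymm' : HasFDerivAt e.symm (A.symm : E →L[ℝ] S × ℝ) x₀ :=
    e.hasFDerivAt_symm hx₀ (by rw [hsymm0]; exact hA)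
  let c : Fin m → S × ℝ →L[ℝ] ℝ := fun k =>
    (LinearMap.toContinuousLinearMap (b.coord k)).comp (ContinuousLinearMap.fst ℝ S ℝ)
  refine ⟨fun k z => c k (e.symm z), fun k => (c k).contDiff.contDiffAt.comp _ hsymm,
    fun k => ?_, ?_⟩
  · have h1 : Filter.Tendsto (fun z => (x₀ + ((e.symm z).1 : E), (e.symm z).2)) (𝓝 x₀)
        (𝓝 (x₀, 0)) := by
      have : ContinuousAt (fun z => (x₀ + ((e.symm z).1 : E), (e.symm z).2)) x₀ := by
        have := hsymm.continuousAt
        fun_prop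
      simpa [ContinuousAt, hsymm0] using this
    filter_upwards [h1.eventually hαd, e.open_target.mem_nhds hx₀,
      hsymm.eventually (by simp)] with z hz hzt hzs
    have hz' : α (x₀ + ((e.symm z).1 : E), (e.symm z).2) = z := e.right_inv hzt
    rw [hz'] at hz
    have h2 : HasFDerivAt (fun z => c k (e.symm z)) (fderiv ℝ (fun z => c k (e.symm z)) z)
        (α (x₀ + ((e.symm z).1 : E), (e.symm z).2)) := by
      rw [hz']
      exact ((c k).differentiableAt.comp z (hzs.differentiableAt one_ne_zero)).hasFDerivAt
    -- Along the flow line through `z` only the time coordinate of `e.symm` changes, so `c k ∘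
    -- e.symm` is constant there and its derivative along `P z` vanishes.
    have h3 := h2.comp_hasDerivAt _ hz
    refine h3.unique ((hasDerivAt_const _ (c k (e.symm z))).congr_of_eventuallyEq ?_)
    have h4 : Filter.Tendsto (fun s : ℝ => ((e.symm z).1, s)) (𝓝 (e.symm z).2) (𝓝 (e.symm z)) :=
      (Continuous.prodMk_right (e.symm z).1).tendsto (e.symm z).2
    filter_upwards [h4.eventually (e.open_source.mem_nhds (e.map_target hzt))] with s hs
    have h5 := e.left_inv hs
    change c k (e.symm (Θ ((e.symm z).1, s))) = _
    rw [← he, h5]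
    rfl
  · have h1 : ∀ k, fderiv ℝ (fun z => c k (e.symm z)) x₀ = (c k).comp (A.symm : E →L[ℝ] S × ℝ) :=
      fun k => ((c k).hasFDerivAt.comp x₀ hsymm').fderiv
    rw [IndependentAt, Fintype.linearIndependent_iff]
    intro g hg i
    have h2 := congrArg (fun φ : E →L[ℝ] ℝ => φ (A (b i, 0))) hg
    simp only [h1] at h2
    simpa [c, Finsupp.single_apply] using h2

/-- A functional that does not kill `v` lies outside the span of the `φ k`, hence extends them to `m
+ 1` independent functionals. -/
theorem lt_finrank_of_linearIndependent_annihilating {m : ℕ} {φ : Fin m → E →L[ℝ] ℝ}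
    (h : LinearIndependent ℝ φ) {v : E} (hv : v ≠ 0) (h0 : ∀ k, φ k v = 0) :
    m < Module.finrank ℝ E := by
  obtain ⟨ℓ, hℓ⟩ := exists_clm_apply_ne_zero hv
  have h1 : LinearIndependent ℝ (Fin.cons ℓ φ : Fin (m + 1) → E →L[ℝ] ℝ) :=
    linearIndependent_finCons.2 ⟨h, fun hmem => hℓ (apply_eq_zero_of_mem_span h0 hmem)⟩
  have h2 := h1.fintype_card_le_finrank
  rw [Fintype.card_fin, ← (LinearMap.toContinuousLinearMap (𝕜 := ℝ) (E := E)
    (F' := ℝ)).finrank_eq, Subspace.dual_finrank_eq] at h2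
  omega

/-- Functions annihilated by a vector field that vanishes on no open set are fewer than the
dimension if they are independent at some point. -/
theorem lt_finrank_of_independentAt {P : E → E} {D : Set E} (hD : IsOpen D)
    (hP : D ⊆ closure {z | z ∈ D ∧ P z ≠ 0}) {m : ℕ} {u : Fin m → E → ℝ}
    (hu : ∀ k, ContDiffOn ℝ 1 (u k) D) (hu0 : ∀ k, ∀ z ∈ D, fderiv ℝ (u k) z (P z) = 0)
    {z : E} (hz : z ∈ D) (h : IndependentAt u z) : m < Module.finrank ℝ E := by
  -- `P` may vanish at `z`; independence persists at nearby points, one of which has `P ≠ 0`.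
  have h1 := h.eventually fun k => (hu k).contDiffAt (hD.mem_nhds hz)
  obtain ⟨w, hw, hwD, hPw⟩ := mem_closure_iff_nhds.1 (hP hz) _ h1
  exact lt_finrank_of_linearIndependent_annihilating hw hPw fun k => hu0 k w hwD

/-- Otherwise `f` and the `u k` would be `m + 1` independent functions annihilated by `P`, one more
than the dimension allows. -/
theorem fderiv_mem_span_of_independentAt {P : E → E} {D : Set E} (hD : IsOpen D)
    (hP : D ⊆ closure {z | z ∈ D ∧ P z ≠ 0}) {m : ℕ} (hm : Module.finrank ℝ E ≤ m + 1)
    {u : Fin m → E → ℝ} (hu : ∀ k, ContDiffOn ℝ 1 (u k) D)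
    (hu0 : ∀ k, ∀ z ∈ D, fderiv ℝ (u k) z (P z) = 0) {f : E → ℝ} (hf : ContDiffOn ℝ 1 f D)
    (hf0 : ∀ z ∈ D, fderiv ℝ f z (P z) = 0) {z : E} (hz : z ∈ D) (h : IndependentAt u z) :
    fderiv ℝ f z ∈ Submodule.span ℝ (range fun k => fderiv ℝ (u k) z) := by
  by_contra hmem
  have h1 : IndependentAt (Fin.cons f u : Fin (m + 1) → E → ℝ) z := by
    have h2 := linearIndependent_finCons.2 ⟨h, hmem⟩
    have h3 : (fun k => fderiv ℝ ((Fin.cons f u : Fin (m + 1) → E → ℝ) k) z) =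
        (Fin.cons (fderiv ℝ f z) fun k => fderiv ℝ (u k) z : Fin (m + 1) → E →L[ℝ] ℝ) :=
      funext (Fin.cases rfl fun _ => rfl)
    rw [IndependentAt, h3]
    exact h2
  have h3 := lt_finrank_of_independentAt hD hP
    (u := (Fin.cons f u : Fin (m + 1) → E → ℝ)) (Fin.cases (by simpa using hf) (by simpa using hu))
    (Fin.cases (by simpa using hf0) (by simpa using hu0)) hz h1
  omega

/-- A function whose differential is a combination of the differentials of independent functions
is locally a function of them. -/
theorem isLocallyFunctionOf_of_fderiv_mem_span {D : Set E} (hD : IsOpen D) {m : ℕ}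
    {u : Fin m → E → ℝ} (hu : ∀ k, ContDiffOn ℝ 1 (u k) D) (hind : ∀ z ∈ D, IndependentAt u z)
    {f : E → ℝ} (hf : ContDiffOn ℝ 1 f D)
    (hspan : ∀ z ∈ D, fderiv ℝ f z ∈ Submodule.span ℝ (range fun k => fderiv ℝ (u k) z)) :
    IsLocallyFunctionOf u D f := by
  intro z hz
  let dU : E →L[ℝ] Fin m → ℝ := ContinuousLinearMap.pi fun k => fderiv ℝ (u k) z
  let S : Submodule ℝ E := dU.ker
  obtain ⟨π₀, hπ₀⟩ := LinearMap.exists_leftInverse_of_injective S.subtype S.ker_subtype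
  let π : E →L[ℝ] S := LinearMap.toContinuousLinearMap π₀
  have hπ : ∀ y : S, π y = y := fun y => congrArg (fun g => g y) hπ₀
  -- A chart at `z`: the `u k` are completed by a linear projection `π` onto the common kernel `S`
  -- of their differentials.
  let Ξ : E → (Fin m → ℝ) × S := fun w => (fun k => u k w, π w)
  have huz : ∀ w ∈ D, ∀ k, ContDiffAt ℝ 1 (u k) w := fun w hw k =>
    (hu k).contDiffAt (hD.mem_nhds hw)
  have hΞ : ContDiffAt ℝ 1 Ξ z := (contDiffAt_pi.2 (huz z hz)).prodMk π.contDiff.contDiffAt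
  have hΞ' : HasFDerivAt Ξ (dU.prod π) z :=
    (hasFDerivAt_pi.2 fun k => ((huz z hz k).differentiableAt one_ne_zero).hasFDerivAt).prodMk
      π.hasFDerivAt
  have hinj : Function.Injective (dU.prod π) := by
    rw [injective_iff_map_eq_zero]
    intro v hv
    have h1 : dU v = 0 := congrArg Prod.fst hv
    have h2 : π v = 0 := congrArg Prod.snd hv
    have h3 := hπ ⟨v, h1⟩
    rw [h2] at h3
    exact congrArg Subtype.val h3.symm
  have hdim : Module.finrank ℝ E = Module.finrank ℝ ((Fin m → ℝ) × S) := by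
    have h1 := LinearMap.finrank_range_add_finrank_ker (dU : E →ₗ[ℝ] Fin m → ℝ)
    rw [show LinearMap.range (dU : E →ₗ[ℝ] Fin m → ℝ) = ⊤ from (hind z hz).range_pi_fderiv_eq_top,
      finrank_top] at h1
    rw [Module.finrank_prod, ← h1]
  let A : E ≃L[ℝ] (Fin m → ℝ) × S :=
    (LinearEquiv.ofInjectiveOfFinrankEq _ hinj hdim).toContinuousLinearEquiv
  have hA : HasFDerivAt Ξ (A : E →L[ℝ] (Fin m → ℝ) × S) z := hΞ'
  let e := hΞ.toOpenPartialHomeomorph Ξ hA one_ne_zero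
  have hez : z ∈ e.source := hΞ.mem_toOpenPartialHomeomorph_source hA one_ne_zero
  have hezt : Ξ z ∈ e.target := e.map_source hez
  have hsymmz : e.symm (Ξ z) = z := e.left_inv hez
  have hsymm : ContDiffAt ℝ 1 e.symm (Ξ z) :=
    e.contDiffAt_symm hezt (f₀' := A) (by rw [hsymmz]; exact hA) (by rw [hsymmz]; exact hΞ)
  have hgood : ∀ᶠ y in 𝓝 (Ξ z), y ∈ e.target ∧ ContDiffAt ℝ 1 e.symm y ∧ e.symm y ∈ D :=
    (e.open_target.eventually_mem hezt).and ((hsymm.eventually (by simp)).and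
      (hsymm.continuousAt.eventually (hD.mem_nhds (by rwa [hsymmz]))))
  obtain ⟨r, hr, hball⟩ := Metric.eventually_nhds_iff_ball.1 hgood
  rw [← ball_prod_same] at hball
  -- On a fibre of fixed `y` all `u j` are constant, so its tangent vectors are killed by every `du
  -- j` and hence by `df`. As the fibre is a ball, `f` is constant on it and may be read off on the
  -- slice through `(Ξ z).2`.
  have hconst : ∀ y ∈ Metric.ball (Ξ z).1 r, ∀ k ∈ Metric.ball (Ξ z).2 r,
      f (e.symm (y, k)) = f (e.symm (y, (Ξ z).2)) := fun y hy k hk => by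
    have hd : ∀ k ∈ Metric.ball (Ξ z).2 r, HasFDerivAt (fun k => f (e.symm (y, k))) 0 k :=
      fun k hk => by
        obtain ⟨hyt, hys, hyD⟩ := hball (y, k) ⟨hy, hk⟩
        have h1 : HasFDerivAt (fun k => e.symm (y, k))
            ((fderiv ℝ e.symm (y, k)).comp (.inr ℝ (Fin m → ℝ) S)) k :=
          HasFDerivAt.comp k (hys.differentiableAt one_ne_zero).hasFDerivAt
            (hasFDerivAt_prodMk_right y k)
        have h2 : ∀ v j, fderiv ℝ (u j) (e.symm (y, k))
            ((fderiv ℝ e.symm (y, k)).comp (.inr ℝ (Fin m → ℝ) S) v) = 0 := fun v j => by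
          have h3 := ((huz _ hyD j).differentiableAt one_ne_zero).hasFDerivAt.comp k h1
          have h4 : (fun _ => y j) =ᶠ[𝓝 k] u j ∘ fun k => e.symm (y, k) := by
            have h5 : Filter.Tendsto (fun k : S => (y, k)) (𝓝 k) (𝓝 (y, k)) :=
              (Continuous.prodMk_right y).tendsto k
            filter_upwards [h5.eventually (e.open_target.mem_nhds hyt)] with k' hk'
            exact (congrArg (fun q => q.1 j) (e.right_inv hk')).symm
          exact congrArg (fun L => L v)
            ((h3.congr_of_eventuallyEq h4).unique (hasFDerivAt_const (y j) k))
        have h3 := (((hf.contDiffAt (hD.mem_nhds hyD)).differentiableAt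
          one_ne_zero).hasFDerivAt).comp k h1
        have h4 : (fderiv ℝ f (e.symm (y, k))).comp
            ((fderiv ℝ e.symm (y, k)).comp (.inr ℝ (Fin m → ℝ) S)) = 0 := by
          ext v
          exact apply_eq_zero_of_mem_span (h2 v) (hspan _ hyD)
        rwa [h4] at h3
    exact Metric.isOpen_ball.is_const_of_fderiv_eq_zero (convex_ball _ _).isPreconnected
      (fun k hk => (hd k hk).differentiableAt.differentiableWithinAt)
      (fun k hk => (hd k hk).fderiv) hk (Metric.mem_ball_self hr)
  refine ⟨e.source ∩ e ⁻¹' (Metric.ball (Ξ z).1 r ×ˢ Metric.ball (Ξ z).2 r),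
    e.isOpen_inter_preimage (Metric.isOpen_ball.prod Metric.isOpen_ball),
    ⟨hez, Metric.mem_ball_self hr, Metric.mem_ball_self hr⟩, fun w hw => ?_,
    Metric.ball (Ξ z).1 r, Metric.isOpen_ball, fun w hw => hw.2.1,
    fun y => f (e.symm (y, (Ξ z).2)), fun y hy => ?_, fun w hw => ?_⟩
  · rw [← e.left_inv hw.1]
    exact (hball _ hw.2).2.2
  · obtain ⟨-, hys, hyD⟩ := hball (y, (Ξ z).2) ⟨hy, Metric.mem_ball_self hr⟩
    exact ((hf.contDiffAt (hD.mem_nhds hyD)).comp y (hys.comp y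
      (contDiffAt_id.prodMk contDiffAt_const))).contDiffWithinAt
  · have h1 := hconst _ hw.2.1 _ hw.2.2
    have h2 : e.symm ((e w).1, (e w).2) = w := e.left_inv hw.1
    rw [h2] at h1
    exact h1

theorem map_nhds_of_independentAt {m : ℕ} {u : Fin m → E → ℝ} {z : E}
    (hu : ∀ k, ContDiffAt ℝ 1 (u k) z) (h : IndependentAt u z) :
    Filter.map (fun w k => u k w) (𝓝 z) = 𝓝 fun k => u k z :=
  HasStrictFDerivAt.map_nhds_eq_of_surj
    (hasStrictFDerivAt_pi.2 fun k => (hu k).hasStrictFDerivAt one_ne_zero)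
    h.range_pi_fderiv_eq_top

/-- If the joint level sets are connected, local functional dependence is global. -/
theorem IsLocallyFunctionOf.isFunctionOf {D : Set E} (hD : IsOpen D) {m : ℕ}
    {u : Fin m → E → ℝ} (hu : ∀ k, ContDiffOn ℝ 1 (u k) D) (hind : ∀ z ∈ D, IndependentAt u z)
    (hconn : ∀ c : Fin m → ℝ, IsPreconnected {z | z ∈ D ∧ ∀ k, u k z = c k})
    {f : E → ℝ} (hf : IsLocallyFunctionOf u D f) : IsFunctionOf u D f := by
  classical
  have hmap : ∀ z ∈ D, ∀ W ∈ 𝓝 z, (fun w k => u k w) '' W ∈ 𝓝 fun k => u k z :=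
    fun z hz W hW => by
      rw [← map_nhds_of_independentAt (fun k => (hu k).contDiffAt (hD.mem_nhds hz)) (hind z hz)]
      exact Filter.image_mem_map hW
  -- Local dependence on `u` makes `f` locally constant on each joint level set, hence constant by
  -- connectedness.
  have hlevel : ∀ z ∈ D, ∀ w ∈ D, (∀ k, u k z = u k w) → f z = f w := fun z hz w hw hzw => by
    refine (hconn fun k => u k z).induction₂ (fun a b => f a = f b) (fun a ha => ?_)
      (fun _ _ _ _ _ _ h h' => h.trans h') (fun _ _ _ _ h => h.symm)
      (x := z) (y := w) ⟨hz, fun _ => rfl⟩ ⟨hw, fun k => (hzw k).symm⟩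
    obtain ⟨W, hWo, haW, -, V, -, -, Φ, -, hΦ⟩ := hf a ha.1
    filter_upwards [mem_nhdsWithin_of_mem_nhds (hWo.mem_nhds haW), self_mem_nhdsWithin] with b hb hb'
    rw [hΦ a haW, hΦ b hb]
    congr 1
    ext k
    rw [ha.2 k, hb'.2 k]
  let Φ : (Fin m → ℝ) → ℝ := fun y =>
    if h : ∃ z ∈ D, (fun k => u k z) = y then f h.choose else 0
  have hΦ : ∀ z ∈ D, f z = Φ fun k => u k z := fun z hz => by
    have h : ∃ w ∈ D, (fun k => u k w) = fun k => u k z := ⟨z, hz, rfl⟩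
    simp only [Φ, dif_pos h]
    exact hlevel _ hz _ h.choose_spec.1 fun k => (congrFun h.choose_spec.2 k).symm
  refine ⟨(fun w k => u k w) '' D, isOpen_iff_mem_nhds.2 ?_, fun w hw => mem_image_of_mem _ hw,
    Φ, ?_, hΦ⟩
  · rintro _ ⟨z, hz, rfl⟩
    exact hmap z hz D (hD.mem_nhds hz)
  · rintro _ ⟨z, hz, rfl⟩
    -- The submersion `u` is open, so the image of `W` is a neighbourhood on which `Φ` agrees with
    -- the local `C¹` function `Φ'`.
    obtain ⟨W, hWo, hzW, hWD, V, hV, hWV, Φ', hΦ', hfΦ'⟩ := hf z hz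
    refine ((hΦ'.contDiffAt (hV.mem_nhds (hWV z hzW))).congr_of_eventuallyEq ?_).contDiffWithinAt
    filter_upwards [hmap z hz W (hWo.mem_nhds hzW)]
    rintro _ ⟨w, hw, rfl⟩
    rw [← hΦ w (hWD hw), hfΦ' w hw]

end FunctionalDependence

/-! ### First integrals of a `C¹` vector field -/

section VectorField

variable {E : Type*} [NormedAddCommGroup E] [NormedSpace ℝ E]

theorem eq_of_fderiv_apply_eq_zero {P : E → E} {D : Set E} (hD : IsOpen D) {f : E → ℝ}
    (hf : ContDiffOn ℝ 1 f D) (hf0 : ∀ z ∈ D, fderiv ℝ f z (P z) = 0) {I : Set ℝ} {γ : ℝ → E}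
    (hγ : IsCharacteristicCurve P D I γ) {s s' : ℝ} (hs : s ∈ I) (hs' : s' ∈ I) :
    f (γ s) = f (γ s') := by
  obtain ⟨hI, hIc, hγ⟩ := hγ
  have hd : ∀ t ∈ I, HasDerivAt (fun t => f (γ t)) 0 t := fun t ht => by
    obtain ⟨hγD, c, hc⟩ := hγ t ht
    have h1 := ((hf.contDiffAt (hD.mem_nhds hγD)).differentiableAt
      one_ne_zero).hasFDerivAt.comp_hasDerivAt t hc
    rwa [map_smul, hf0 _ hγD, smul_zero] at h1
  exact hI.is_const_of_deriv_eq_zero hIc.isPreconnected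
    (fun t ht => (hd t ht).differentiableAt.differentiableWithinAt)
    (fun t ht => (hd t ht).deriv) hs hs'

theorem exists_integralCurve [CompleteSpace E] {P : E → E} {D : Set E} (hD : IsOpen D)
    (hP : ContDiffOn ℝ 1 P D) {z : E} (hz : z ∈ D) (t₀ : ℝ) :
    ∃ γ : ℝ → E, γ t₀ = z ∧ ∃ ε > (0 : ℝ), ∀ t ∈ Ioo (t₀ - ε) (t₀ + ε),
      γ t ∈ D ∧ HasDerivAt γ (P (γ t)) t := by
  obtain ⟨γ, hγ0, ε, hε, hγ⟩ :=
    (hP.contDiffAt (hD.mem_nhds hz)).exists_forall_mem_closedBall_exists_eq_forall_mem_Ioo_hasDerivAt₀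
      t₀
  have hc : ContinuousAt γ t₀ := (hγ t₀ ⟨by linarith, by linarith⟩).continuousAt
  obtain ⟨δ, hδ, hball⟩ := Metric.eventually_nhds_iff_ball.1
    (hc.eventually (hD.mem_nhds (by rwa [hγ0])))
  refine ⟨γ, hγ0, min ε δ, lt_min hε hδ, fun t ht => ⟨hball t ?_, hγ t ?_⟩⟩
  · rw [Real.ball_eq_Ioo]
    exact ⟨by linarith [ht.1, min_le_right ε δ], by linarith [ht.2, min_le_right ε δ]⟩
  · exact ⟨by linarith [ht.1, min_le_left ε δ], by linarith [ht.2, min_le_left ε δ]⟩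

theorem fderiv_apply_eq_zero_of_const {P : E → E} {f : E → ℝ} {γ : ℝ → E} {t₀ : ℝ}
    (hf : DifferentiableAt ℝ f (γ t₀)) (hγ : HasDerivAt γ (P (γ t₀)) t₀)
    (h : ∀ᶠ t in 𝓝 t₀, f (γ t) = f (γ t₀)) : fderiv ℝ f (γ t₀) (P (γ t₀)) = 0 :=
  (hf.hasFDerivAt.comp_hasDerivAt t₀ hγ).unique
    ((hasDerivAt_const t₀ (f (γ t₀))).congr_of_eventuallyEq h)

/-- Integral curves are characteristic curves with factor `c = 1`, and one passes through each point
of `D`; differentiating `f` along it gives `df(P) = 0`. The converse is the chain rule, for any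
factor `c`. -/
theorem isFirstIntegral_iff [CompleteSpace E] {P : E → E} {D : Set E} (hD : IsOpen D)
    (hP : ContDiffOn ℝ 1 P D) {f : E → ℝ} :
    IsFirstIntegral P D f ↔ ContDiffOn ℝ 1 f D ∧ ∀ z ∈ D, fderiv ℝ f z (P z) = 0 := by
  refine ⟨fun h => ⟨h.1, fun z hz => ?_⟩,
    fun h => ⟨h.1, fun I γ hγ s hs s' hs' => eq_of_fderiv_apply_eq_zero hD h.1 h.2 hγ hs hs'⟩⟩
  obtain ⟨γ, rfl, ε, hε, hγ⟩ := exists_integralCurve hD hP hz 0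
  have h0 : (0 : ℝ) ∈ Ioo (0 - ε) (0 + ε) := ⟨by linarith, by linarith⟩
  refine fderiv_apply_eq_zero_of_const
    ((h.1.contDiffAt (hD.mem_nhds hz)).differentiableAt one_ne_zero) (hγ 0 h0).2 ?_
  filter_upwards [Ioo_mem_nhds h0.1 h0.2] with t ht
  exact h.2 _ γ ⟨isOpen_Ioo, ordConnected_Ioo, fun s hs =>
    ⟨(hγ s hs).1, 1, by simpa using (hγ s hs).2⟩⟩ t ht 0 h0

variable [FiniteDimensional ℝ E]

theorem exists_independent_firstIntegrals {P : E → E} {D : Set E} (hD : IsOpen D)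
    (hP : ContDiffOn ℝ 1 P D) {m : ℕ} (hm : Module.finrank ℝ E = m + 1) {z : E} (hz : z ∈ D)
    (hPz : P z ≠ 0) :
    ∃ W : Set E, IsOpen W ∧ z ∈ W ∧ W ⊆ D ∧ ∃ u : Fin m → E → ℝ,
      (∀ k, IsFirstIntegral P W (u k)) ∧ ∀ w ∈ W, IndependentAt u w := by
  obtain ⟨u, hu, hu0, hind⟩ :=
    exists_independentAt_annihilating (hP.contDiffAt (hD.mem_nhds hz)) hPz hm
  have h : ∀ᶠ w in 𝓝 z, w ∈ D ∧ (∀ k, ContDiffAt ℝ 1 (u k) w) ∧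
      (∀ k, fderiv ℝ (u k) w (P w) = 0) ∧ IndependentAt u w :=
    (hD.eventually_mem hz).and ((Filter.eventually_all.2 fun k => (hu k).eventually (by simp)).and
      ((Filter.eventually_all.2 hu0).and (hind.eventually hu)))
  obtain ⟨W, hW, hWo, hzW⟩ := mem_nhds_iff.1 h
  exact ⟨W, hWo, hzW, fun w hw => (hW hw).1, u, fun k => (isFirstIntegral_iff hWo
    (hP.mono fun w hw => (hW hw).1)).2 ⟨fun w hw => ((hW hw).2.1 k).contDiffWithinAt,
      fun w hw => (hW hw).2.2.1 k⟩, fun w hw => (hW hw).2.2.2⟩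

theorem isFirstIntegral_iff_isLocallyFunctionOf {P : E → E} {D : Set E} (hD : IsOpen D)
    (hP : ContDiffOn ℝ 1 P D) (hP0 : D ⊆ closure {z | z ∈ D ∧ P z ≠ 0}) {m : ℕ}
    (hm : Module.finrank ℝ E ≤ m + 1) {u : Fin m → E → ℝ} (hu : ∀ k, IsFirstIntegral P D (u k))
    (hind : ∀ z ∈ D, IndependentAt u z) {f : E → ℝ} :
    IsFirstIntegral P D f ↔ IsLocallyFunctionOf u D f := by
  have hu' := fun k => (isFirstIntegral_iff hD hP).1 (hu k)
  rw [isFirstIntegral_iff hD hP]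
  refine ⟨fun h => isLocallyFunctionOf_of_fderiv_mem_span hD (fun k => (hu' k).1) hind h.1
    fun z hz => fderiv_mem_span_of_independentAt hD hP0 hm (fun k => (hu' k).1)
      (fun k => (hu' k).2) h.1 h.2 hz (hind z hz), fun h => ?_⟩
  have h1 := fun z (hz : z ∈ D) =>
    h.contDiffAt_and_fderiv_eq_zero hD (fun k => (hu' k).1) hz
  exact ⟨fun z hz => (h1 z hz).1.contDiffWithinAt,
    fun z hz => (h1 z hz).2 _ fun k => (hu' k).2 z hz⟩

theorem isFirstIntegral_iff_isFunctionOf {P : E → E} {D : Set E} (hD : IsOpen D)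
    (hP : ContDiffOn ℝ 1 P D) (hP0 : D ⊆ closure {z | z ∈ D ∧ P z ≠ 0}) {m : ℕ}
    (hm : Module.finrank ℝ E ≤ m + 1) {u : Fin m → E → ℝ} (hu : ∀ k, IsFirstIntegral P D (u k))
    (hind : ∀ z ∈ D, IndependentAt u z)
    (hconn : ∀ c : Fin m → ℝ, IsPreconnected {z | z ∈ D ∧ ∀ k, u k z = c k}) {f : E → ℝ} :
    IsFirstIntegral P D f ↔ IsFunctionOf u D f := by
  rw [isFirstIntegral_iff_isLocallyFunctionOf hD hP hP0 hm hu hind]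
  exact ⟨fun h => h.isFunctionOf hD (fun k => (hu k).1) hind hconn,
    fun h _ hz => ⟨D, hD, hz, Subset.rfl, h⟩⟩

theorem lt_finrank_of_isFirstIntegral {P : E → E} {D : Set E} (hD : IsOpen D)
    (hP : ContDiffOn ℝ 1 P D) (hP0 : D ⊆ closure {z | z ∈ D ∧ P z ≠ 0}) {m : ℕ}
    {u : Fin m → E → ℝ} (hu : ∀ k, IsFirstIntegral P D (u k)) {z : E} (hz : z ∈ D)
    (h : IndependentAt u z) : m < Module.finrank ℝ E :=
  lt_finrank_of_independentAt hD hP0 (fun k => (hu k).1)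
    (fun k => ((isFirstIntegral_iff hD hP).1 (hu k)).2) hz h

end VectorField

/-! ### Poisson brackets, motions and conserved quantities -/

section Hamiltonian

variable {n : ℕ}

theorem fderiv_apply_hamField (A B : Phase n → ℝ) (x : Phase n) :
    fderiv ℝ A x (hamField B x) = poisson A B x := by
  have h1 : hamField B x = ∑ i, (partialP B i x • ((Pi.single i 1, 0) : Phase n) -
      partialQ B i x • ((0, Pi.single i 1) : Phase n)) := by
    ext j <;> simp [hamField, Prod.fst_sum, Prod.snd_sum, Finset.sum_apply, Pi.single_apply]
  rw [h1, map_sum, poisson]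
  refine Finset.sum_congr rfl fun i _ => ?_
  rw [map_sub, map_smul, map_smul, smul_eq_mul, smul_eq_mul]
  simp only [partialQ, partialP]
  ring

theorem hasFDerivAt_atTime {f : ExtPhase n → ℝ} {z : ExtPhase n} (hf : DifferentiableAt ℝ f z) :
    HasFDerivAt (atTime f z.2) ((fderiv ℝ f z).comp (.inl ℝ (Phase n) ℝ)) z.1 :=
  HasFDerivAt.comp (g := f) z.1 hf.hasFDerivAt (hasFDerivAt_prodMk_left z.1 z.2)

theorem fderiv_apply_extHamField (H : ExtPhase n → ℝ) {f : ExtPhase n → ℝ} {z : ExtPhase n}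
    (hf : DifferentiableAt ℝ f z) : fderiv ℝ f z (extHamField H z) = totalDeriv H f z := by
  have h1 : HasDerivAt (fun t => f (z.1, t)) (fderiv ℝ f z (0, 1)) z.2 :=
    HasFDerivAt.comp_hasDerivAt (l := f) z.2 hf.hasFDerivAt
      ((hasDerivAt_const z.2 z.1).prodMk (hasDerivAt_id z.2))
  rw [totalDeriv, ← fderiv_apply_hamField, (hasFDerivAt_atTime hf).fderiv, h1.deriv,
    ContinuousLinearMap.comp_apply, ContinuousLinearMap.inl_apply, ← map_add]
  simp [extHamField]

theorem contDiffOn_hamField {D : Set (Phase n)} (hD : IsOpen D) {H : Phase n → ℝ}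
    (hH : ContDiffOn ℝ 2 H D) : ContDiffOn ℝ 1 (hamField H) D := by
  have h1 : ContDiffOn ℝ 1 (fderiv ℝ H) D := hH.fderiv_of_isOpen hD (by norm_num)
  exact (contDiffOn_pi.2 fun i => h1.clm_apply contDiffOn_const).prodMk
    (contDiffOn_pi.2 fun i => (h1.clm_apply contDiffOn_const).neg)

theorem contDiffOn_extHamField {D : Set (ExtPhase n)} (hD : IsOpen D) {H : ExtPhase n → ℝ}
    (hH : ContDiffOn ℝ 2 H D) : ContDiffOn ℝ 1 (extHamField H) D := by
  have h1 : ContDiffOn ℝ 1 (fderiv ℝ H) D := hH.fderiv_of_isOpen hD (by norm_num)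
  have h2 : ContDiffOn ℝ 1 (fun z : ExtPhase n =>
      (((fun i => fderiv ℝ H z ((0, Pi.single i 1), 0),
        fun i => -fderiv ℝ H z ((Pi.single i 1, 0), 0)), 1) : ExtPhase n)) D :=
    ((contDiffOn_pi.2 fun i => h1.clm_apply contDiffOn_const).prodMk
      (contDiffOn_pi.2 fun i => (h1.clm_apply contDiffOn_const).neg)).prodMk contDiffOn_const
  refine h2.congr fun z hz => ?_
  have h3 := (hasFDerivAt_atTime
    ((hH.contDiffAt (hD.mem_nhds hz)).differentiableAt two_ne_zero)).fderiv
  simp [extHamField, hamField, partialP, partialQ, h3]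

theorem extHamField_ne_zero (H : ExtPhase n → ℝ) (z : ExtPhase n) : extHamField H z ≠ 0 :=
  fun h => one_ne_zero (congrArg Prod.snd h)

theorem IsMotion.hasDerivAt {H : ExtPhase n → ℝ} {D : Set (ExtPhase n)} {I : Set ℝ}
    {x : ℝ → Phase n} (hx : IsMotion H D I x) {t : ℝ} (ht : t ∈ I) :
    HasDerivAt (fun s => (x s, s)) (extHamField H (x t, t)) t :=
  (hx.2.2 t ht).2.prodMk (hasDerivAt_id t)

theorem IsMotion.isCharacteristicCurve {H : ExtPhase n → ℝ} {D : Set (ExtPhase n)} {I : Set ℝ}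
    {x : ℝ → Phase n} (hx : IsMotion H D I x) :
    IsCharacteristicCurve (extHamField H) D I fun s => (x s, s) :=
  ⟨hx.1, hx.2.1, fun t ht => ⟨(hx.2.2 t ht).1, 1, by simpa using hx.hasDerivAt ht⟩⟩

theorem exists_isMotion {D : Set (ExtPhase n)} (hD : IsOpen D) {H : ExtPhase n → ℝ}
    (hH : ContDiffOn ℝ 2 H D) {z : ExtPhase n} (hz : z ∈ D) :
    ∃ x : ℝ → Phase n, x z.2 = z.1 ∧ ∃ I ∈ 𝓝 z.2, IsMotion H D I x := by
  obtain ⟨γ, hγ0, ε, hε, hγ⟩ := exists_integralCurve hD (contDiffOn_extHamField hD hH) hz z.2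
  have h0 : z.2 ∈ Ioo (z.2 - ε) (z.2 + ε) := ⟨by linarith, by linarith⟩
  -- The time component of the extended field is `1`, so an integral curve starting at parameter
  -- `z.2` is parametrized by time itself and its phase component is a motion.
  have hd : ∀ t ∈ Ioo (z.2 - ε) (z.2 + ε), HasDerivAt (fun t => (γ t).2 - t) 0 t := fun t ht => by
    have h1 : HasDerivAt (fun t => (γ t).2) 1 t :=
      (ContinuousLinearMap.snd ℝ (Phase n) ℝ).hasFDerivAt.comp_hasDerivAt t (hγ t ht).2
    have h2 := h1.sub (hasDerivAt_id t)
    rwa [sub_self] at h2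
  have htime : ∀ t ∈ Ioo (z.2 - ε) (z.2 + ε), (γ t).2 = t := fun t ht => by
    have h1 := isOpen_Ioo.is_const_of_deriv_eq_zero isPreconnected_Ioo
      (fun t ht => (hd t ht).differentiableAt.differentiableWithinAt)
      (fun t ht => (hd t ht).deriv) ht h0
    simp only [hγ0, sub_self] at h1
    linarith
  refine ⟨fun t => (γ t).1, by simp only [hγ0], _, Ioo_mem_nhds h0.1 h0.2, isOpen_Ioo,
    ordConnected_Ioo, fun t ht => ?_⟩
  have h1 : ((γ t).1, t) = γ t := Prod.ext rfl (htime t ht).symm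
  refine ⟨by rw [h1]; exact (hγ t ht).1, ?_⟩
  have h2 : HasDerivAt (fun t => (γ t).1) (extHamField H (γ t)).1 t :=
    (ContinuousLinearMap.fst ℝ (Phase n) ℝ).hasFDerivAt.comp_hasDerivAt t (hγ t ht).2
  rwa [← h1] at h2

theorem isConserved_iff_isFirstIntegral {D : Set (ExtPhase n)} (hD : IsOpen D)
    {H : ExtPhase n → ℝ} (hH : ContDiffOn ℝ 2 H D) {f : ExtPhase n → ℝ} :
    IsConserved H D f ↔ IsFirstIntegral (extHamField H) D f := by
  refine ⟨fun h => (isFirstIntegral_iff hD (contDiffOn_extHamField hD hH)).2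
    ⟨h.1, fun z hz => ?_⟩, fun h => ⟨h.1, fun I x hx t ht t' ht' =>
      h.2 I _ hx.isCharacteristicCurve t ht t' ht'⟩⟩
  obtain ⟨x, hx0, I, hI, hx⟩ := exists_isMotion hD hH hz
  have hz' : (x z.2, z.2) = z := Prod.ext hx0 rfl
  have h1 := fderiv_apply_eq_zero_of_const (P := extHamField H) (f := f)
    (γ := fun s => (x s, s)) (t₀ := z.2)
    (by rw [hz']; exact (h.1.contDiffAt (hD.mem_nhds hz)).differentiableAt one_ne_zero)
    (hx.hasDerivAt (mem_of_mem_nhds hI))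
    (Filter.eventually_of_mem hI fun t ht => h.2 I x hx t ht z.2 (mem_of_mem_nhds hI))
  rwa [hz'] at h1

theorem isFirstIntegral_extHamField_iff {D : Set (ExtPhase n)} (hD : IsOpen D)
    {H : ExtPhase n → ℝ} (hH : ContDiffOn ℝ 2 H D) {f : ExtPhase n → ℝ} :
    IsFirstIntegral (extHamField H) D f ↔
      ContDiffOn ℝ 1 f D ∧ ∀ z ∈ D, totalDeriv H f z = 0 := by
  rw [isFirstIntegral_iff hD (contDiffOn_extHamField hD hH)]
  refine and_congr_right fun hf => forall₂_congr fun z hz => ?_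
  rw [fderiv_apply_extHamField H
    ((hf.contDiffAt (hD.mem_nhds hz)).differentiableAt one_ne_zero)]

theorem totalDeriv_lift (H f : Phase n → ℝ) (z : ExtPhase n) :
    totalDeriv (lift H) (lift f) z = poisson f H z.1 := by
  have h1 : deriv (fun t => lift f (z.1, t)) z.2 = 0 := deriv_const z.2 (f z.1)
  rw [totalDeriv, h1, add_zero]
  rfl

theorem contDiffOn_lift_iff {D : Set (Phase n)} {k : ℕ} {f : Phase n → ℝ} :
    ContDiffOn ℝ k (lift f) (D ×ˢ univ) ↔ ContDiffOn ℝ k f D :=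
  ⟨fun h => h.comp (f := fun x : Phase n => (x, (0 : ℝ)))
      (contDiff_id.prodMk contDiff_const).contDiffOn fun _ hx => ⟨hx, trivial⟩,
    fun h => h.comp contDiff_fst.contDiffOn fun _ hz => hz.1⟩

theorem isConservedAutonomous_iff_poisson {D : Set (Phase n)} (hD : IsOpen D) {H : Phase n → ℝ}
    (hH : ContDiffOn ℝ 2 H D) {f : Phase n → ℝ} :
    IsConservedAutonomous H D f ↔ ContDiffOn ℝ 1 f D ∧ ∀ x ∈ D, poisson f H x = 0 := by
  have hD' : IsOpen (D ×ˢ (univ : Set ℝ)) := hD.prod isOpen_univ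
  have hH' : ContDiffOn ℝ 2 (lift H) (D ×ˢ univ) := contDiffOn_lift_iff (k := 2).2 hH
  rw [IsConservedAutonomous, isConserved_iff_isFirstIntegral hD' hH',
    isFirstIntegral_extHamField_iff hD' hH']
  refine and_congr (contDiffOn_lift_iff (k := 1)) ⟨fun h x hx => ?_, fun h z hz => ?_⟩
  · rw [← h (x, 0) ⟨hx, trivial⟩, totalDeriv_lift]
  · rw [totalDeriv_lift, h _ hz.1]

theorem isConservedAutonomous_iff_isFirstIntegral {D : Set (Phase n)} (hD : IsOpen D)
    {H : Phase n → ℝ} (hH : ContDiffOn ℝ 2 H D) {f : Phase n → ℝ} :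
    IsConservedAutonomous H D f ↔ IsFirstIntegral (hamField H) D f := by
  rw [isConservedAutonomous_iff_poisson hD hH,
    isFirstIntegral_iff hD (contDiffOn_hamField hD hH)]
  simp only [fderiv_apply_hamField]

theorem finrank_phase (n : ℕ) : Module.finrank ℝ (Phase n) = 2 * n := by
  simp [two_mul]

theorem finrank_extPhase (n : ℕ) : Module.finrank ℝ (ExtPhase n) = 2 * n + 1 := by
  simp [two_mul]

end Hamiltonian

end HamiltonianMechanics

end

/-! ### The general and the time-independent case -/

open HamiltonianMechanics in
theorem mainTheorem1 (n : ℕ) :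
    -- conserved quantities `f(q, p, t)` of a Hamiltonian `H(q, p, t)` on an open set `D`
    (∀ (D : Set (ExtPhase n)) (H : ExtPhase n → ℝ), IsOpen D → ContDiffOn ℝ 2 H D →
      -- `df/dt = {f, H} + ∂f/∂t` along every motion
      (∀ f : ExtPhase n → ℝ, ContDiffOn ℝ 1 f D →
        ∀ (I : Set ℝ) (x : ℝ → Phase n), IsMotion H D I x →
          ∀ t ∈ I, HasDerivAt (fun s => f (x s, s)) (totalDeriv H f (x t, t)) t) ∧
      -- conserved quantities are the `C¹` solutions of `{f, H} + ∂f/∂t = 0`,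
      -- and these are the first integrals of the subsidiary system
      (∀ f : ExtPhase n → ℝ, ContDiffOn ℝ 1 f D →
        (IsConserved H D f ↔ ∀ z ∈ D, totalDeriv H f z = 0) ∧
        (IsConserved H D f ↔ IsFirstIntegral (extHamField H) D f)) ∧
      -- given `2n` independent first integrals, the conserved quantities are exactly the
      -- functions `Φ(u₁, …, u₂ₙ)`: near each point, and on all of `D` if the joint level
      -- sets of the integrals in `D` are connected
      (∀ u : Fin (2 * n) → ExtPhase n → ℝ,
        (∀ k, IsFirstIntegral (extHamField H) D (u k)) → (∀ z ∈ D, IndependentAt u z) →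
          (∀ f : ExtPhase n → ℝ, IsConserved H D f ↔ IsLocallyFunctionOf u D f) ∧
          ((∀ c : Fin (2 * n) → ℝ, IsPreconnected {z | z ∈ D ∧ ∀ k, u k z = c k}) →
            ∀ f : ExtPhase n → ℝ, IsConserved H D f ↔ IsFunctionOf u D f)) ∧
      -- near each point there are `2n` independent first integrals
      (∀ z ∈ D, ∃ W : Set (ExtPhase n), IsOpen W ∧ z ∈ W ∧ W ⊆ D ∧
        ∃ u : Fin (2 * n) → ExtPhase n → ℝ,
          (∀ k, IsFirstIntegral (extHamField H) W (u k)) ∧ ∀ w ∈ W, IndependentAt u w) ∧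
      -- and there are never more
      (∀ (m : ℕ) (u : Fin m → ExtPhase n → ℝ), (∀ k, IsFirstIntegral (extHamField H) D (u k)) →
        ∀ z ∈ D, IndependentAt u z → m ≤ 2 * n)) ∧
    -- time-independent conserved quantities `f(q, p)` of a Hamiltonian `H(q, p)` on an open set `D`
    (∀ (D : Set (Phase n)) (H : Phase n → ℝ), IsOpen D → ContDiffOn ℝ 2 H D →
      (∀ f : Phase n → ℝ, ContDiffOn ℝ 1 f D →
        (IsConservedAutonomous H D f ↔ ∀ x ∈ D, poisson f H x = 0) ∧
        (IsConservedAutonomous H D f ↔ IsFirstIntegral (hamField H) D f)) ∧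
      -- near each point that is not an equilibrium there are `2n - 1` independent first integrals
      (∀ x ∈ D, hamField H x ≠ 0 → ∃ W : Set (Phase n), IsOpen W ∧ x ∈ W ∧ W ⊆ D ∧
        ∃ u : Fin (2 * n - 1) → Phase n → ℝ,
          (∀ k, IsFirstIntegral (hamField H) W (u k)) ∧ ∀ w ∈ W, IndependentAt u w) ∧
      -- if the equilibria fill no open set, then `2n - 1` independent first integrals give all
      -- conserved quantities, and there are never more
      (D ⊆ closure {x | x ∈ D ∧ hamField H x ≠ 0} →
        (∀ u : Fin (2 * n - 1) → Phase n → ℝ,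
          (∀ k, IsFirstIntegral (hamField H) D (u k)) → (∀ x ∈ D, IndependentAt u x) →
            (∀ f : Phase n → ℝ, IsConservedAutonomous H D f ↔ IsLocallyFunctionOf u D f) ∧
            ((∀ c : Fin (2 * n - 1) → ℝ, IsPreconnected {x | x ∈ D ∧ ∀ k, u k x = c k}) →
              ∀ f : Phase n → ℝ, IsConservedAutonomous H D f ↔ IsFunctionOf u D f)) ∧
        (∀ (m : ℕ) (u : Fin m → Phase n → ℝ), (∀ k, IsFirstIntegral (hamField H) D (u k)) →
          ∀ x ∈ D, IndependentAt u x → m ≤ 2 * n - 1))) := by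
  refine ⟨fun D H hD hH => ?_, fun D H hD hH => ?_⟩
  · have hP := contDiffOn_extHamField hD hH
    -- The time component `1` keeps the extended field from vanishing anywhere, so density is
    -- automatic.
    have hP0 : D ⊆ closure {z | z ∈ D ∧ extHamField H z ≠ 0} := fun z hz =>
      subset_closure ⟨hz, extHamField_ne_zero H z⟩
    refine ⟨fun f hf I x hx t ht => ?_, fun f hf => ⟨?_, isConserved_iff_isFirstIntegral hD hH⟩,
      fun u hu hind => ⟨fun f => ?_, fun hconn f => ?_⟩, fun z hz => ?_, fun m u hu z hz h => ?_⟩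
    · have hd := (hf.contDiffAt (hD.mem_nhds (hx.2.2 t ht).1)).differentiableAt one_ne_zero
      rw [← fderiv_apply_extHamField H hd]
      exact hd.hasFDerivAt.comp_hasDerivAt_of_eq t (hx.hasDerivAt ht) rfl
    · rw [isConserved_iff_isFirstIntegral hD hH, isFirstIntegral_extHamField_iff hD hH]
      exact and_iff_right hf
    · rw [isConserved_iff_isFirstIntegral hD hH]
      exact isFirstIntegral_iff_isLocallyFunctionOf hD hP hP0 (finrank_extPhase n).le hu hind
    · rw [isConserved_iff_isFirstIntegral hD hH]
      exact isFirstIntegral_iff_isFunctionOf hD hP hP0 (finrank_extPhase n).le hu hind hconn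
    · exact exists_independent_firstIntegrals hD hP (finrank_extPhase n) hz
        (extHamField_ne_zero H z)
    · have h1 := lt_finrank_of_isFirstIntegral hD hP hP0 hu hz h
      rw [finrank_extPhase] at h1
      omega
  · have hP := contDiffOn_hamField hD hH
    -- Only an inequality: for `n = 0` the truncated `2 * n - 1` is `0` and the dimension is `0`.
    have hm : Module.finrank ℝ (Phase n) ≤ 2 * n - 1 + 1 := by
      rw [finrank_phase]
      omega
    refine ⟨fun f hf => ⟨?_, isConservedAutonomous_iff_isFirstIntegral hD hH⟩,
      fun x hx hx0 => ?_, fun hP0 => ⟨fun u hu hind => ⟨fun f => ?_, fun hconn f => ?_⟩,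
        fun m u hu x hx h => ?_⟩⟩
    · rw [isConservedAutonomous_iff_poisson hD hH]
      exact and_iff_right hf
    · have hn : Module.finrank ℝ (Phase n) = 2 * n - 1 + 1 := by
        rcases Nat.eq_zero_or_pos n with rfl | hn
        · exact absurd (Subsingleton.elim _ _) hx0
        · rw [finrank_phase]
          omega
      exact exists_independent_firstIntegrals hD hP hn hx hx0
    · rw [isConservedAutonomous_iff_isFirstIntegral hD hH]
      exact isFirstIntegral_iff_isLocallyFunctionOf hD hP hP0 hm hu hind
    · rw [isConservedAutonomous_iff_isFirstIntegral hD hH]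
      exact isFirstIntegral_iff_isFunctionOf hD hP hP0 hm hu hind hconn
    · have h1 := lt_finrank_of_isFirstIntegral hD hP hP0 hu hx h
      rw [finrank_phase] at h1
      omega
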